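/- Let $(R,\mathfrak m)$ be a commutative Noetherian local ring and let $M$ be a finitely generated $R$-module with projective dimension $\operatorname{pd}_R(M)=1$ that is locally free on the punctured spectrum, i.e. $M_{\mathfrak p}$ is a free $R_{\mathfrak p}$-module for every prime ideal $\mathfrak p\neq\mathfrak m$. Write $M^{\otimes i}$ for the $i$-fold tensor power of $M$ over $R$ (with $M^{\otimes 0}=R$). Then $\operatorname{depth}(R)$ is finite, and: (i) $\operatorname{depth}(M^{\otimes i})=\operatorname{depth}(R)-i$ for all integers $i$ with $0<i\le\operatorname{depth}(R)$; (ii) $\operatorname{depth}(M^{\otimes i})=0$ for all integers $i\ge\operatorname{depth}(R)$. Consequently $\operatorname{depth}(M^{\otimes i})=\max\{0,\operatorname{depth}(R)-i\}$ for all integers $i\ge 0$. -/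

import Mathlib

universe u v

open scoped TensorProduct

/-- The depth of a module `M` over a local ring `(R, 𝔪)`: the supremum of the lengths of the
`M`-regular sequences contained in `𝔪`, with the usual convention that it is `∞` if `𝔪 M = M`
(for finitely generated `M` this happens only if `M = 0`). -/
noncomputable def moduleDepth (R : Type*) [CommRing R] [IsLocalRing R]
    (M : Type*) [AddCommGroup M] [Module R M] : ℕ∞ :=
  open Classical in
  if IsLocalRing.maximalIdeal R • (⊤ : Submodule R M) = ⊤ then ⊤
  else ⨆ (rs : List R) (_ : ∀ r ∈ rs, r ∈ IsLocalRing.maximalIdeal R)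
    (_ : RingTheory.Sequence.IsRegular M rs), (rs.length : ℕ∞)

/-- `M` is locally free on the punctured spectrum of the local ring `(R, 𝔪)`: the localization
`M_𝔭` is a free `R_𝔭`-module for every prime ideal `𝔭 ≠ 𝔪`. -/
def IsLocallyFreeOnPuncturedSpectrum (R : Type*) [CommRing R] [IsLocalRing R]
    (M : Type*) [AddCommGroup M] [Module R M] : Prop :=
  ∀ p : PrimeSpectrum R, p.asIdeal ≠ IsLocalRing.maximalIdeal R →
    Module.Free (Localization.AtPrime p.asIdeal) (LocalizedModule p.asIdeal.primeCompl M)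

/-!
Let `0 → K → F → M → 0` be a minimal free resolution of `M`, and let `N ≠ 0` be finitely
generated. If `depth N > 0`, then `K ⊗ N → F ⊗ N` is injective, i.e. `Tor₁(M, N) = 0`: the kernel is
supported at `𝔪` because `M` is flat elsewhere, while `K ⊗ N`, a power of `N`, has no nonzero
`𝔪`-torsion. By minimality this map has entries in `𝔪`, so it induces zero on `Ext(k, -)`, and the
long exact sequence gives `depth (M ⊗ N) = depth N - 1`. If `depth N = 0`, let `Γ ≠ 0` be the
`𝔪`-power torsion of `N`. Then `Tor₁(M, N / Γ) = 0` by the first case, so `M ⊗ Γ ≠ 0` embeds in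
`M ⊗ N` and `depth (M ⊗ N) = 0`. Iterating from `N = R` gives the depths of all tensor powers.
-/

universe w

open CategoryTheory Abelian IsLocalRing Module RingTheory.Sequence

lemma isWeaklyRegular_tensorProduct_iff_of_faithfullyFlat {R : Type*} [CommRing R]
    {K N : Type*} [AddCommGroup K] [Module R K] [FaithfullyFlat R K]
    [AddCommGroup N] [Module R N] {rs : List R} :
    IsWeaklyRegular (K ⊗[R] N) rs ↔ IsWeaklyRegular N rs := by
  induction rs generalizing N with
  | nil => simp only [IsWeaklyRegular.nil]
  | cons r rs ih =>
    have hr : IsSMulRegular (K ⊗[R] N) r ↔ IsSMulRegular N r := by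
      have h := FaithfullyFlat.lTensor_injective_iff_injective R K (DistribSMul.toLinearMap R N r)
      rwa [LinearMap.lTensor_smul_action] at h
    rw [isWeaklyRegular_cons_iff, isWeaklyRegular_cons_iff, hr,
      ← (QuotSMulTop.tensorQuotSMulTopEquivQuotSMulTop r K N).isWeaklyRegular_congr, ih]

section Depth

variable {R : Type*} [CommRing R] [IsLocalRing R] {N : Type*} [AddCommGroup N] [Module R N]

lemma moduleDepth_congr {N' : Type*} [AddCommGroup N'] [Module R N'] (e : N ≃ₗ[R] N') :
    moduleDepth R N = moduleDepth R N' := by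
  have hmap : (maximalIdeal R • (⊤ : Submodule R N)).map e.toLinearMap =
      maximalIdeal R • (⊤ : Submodule R N') := by
    rw [Submodule.map_smul'', Submodule.map_top, e.range]
  have htop : maximalIdeal R • (⊤ : Submodule R N) = ⊤ ↔
      maximalIdeal R • (⊤ : Submodule R N') = ⊤ := by
    rw [← hmap, Submodule.map_eq_top_iff]
  simp only [moduleDepth, htop, e.isRegular_congr]

lemma natCast_le_moduleDepth_iff [Module.Finite R N] [Nontrivial N] {n : ℕ} :
    (n : ℕ∞) ≤ moduleDepth R N ↔
      ∃ rs : List R, rs.length = n ∧ (∀ r ∈ rs, r ∈ maximalIdeal R) ∧ IsWeaklyRegular N rs := by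
  have hN : maximalIdeal R • (⊤ : Submodule R N) ≠ ⊤ :=
    (Submodule.top_ne_ideal_smul_of_le_jacobson_annihilator (maximalIdeal_le_jacobson _)).symm
  rw [moduleDepth, if_neg hN]
  constructor
  · intro h
    obtain _ | n := n
    · exact ⟨[], rfl, by simp, .nil R N⟩
    obtain ⟨rs, h𝔪, hrs, hlen⟩ : ∃ rs : List R, ∃ _ : ∀ r ∈ rs, r ∈ maximalIdeal R,
        ∃ _ : IsRegular N rs, (n : ℕ∞) < rs.length := by
      simpa only [lt_iSup_iff] using (Nat.cast_lt.2 n.lt_succ_self).trans_le h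
    have htake := hrs.toIsWeaklyRegular
    rw [← List.take_append_drop (n + 1) rs, isWeaklyRegular_append_iff] at htake
    exact ⟨rs.take (n + 1), List.length_take_of_le (Nat.cast_lt.1 hlen),
      fun r hr ↦ h𝔪 r (List.mem_of_mem_take hr), htake.1⟩
  · rintro ⟨rs, rfl, h𝔪, hrs⟩
    exact le_iSup₂_of_le rs h𝔪
      (le_iSup_of_le (.of_isWeaklyRegular_of_mem_maximalIdeal N h𝔪 hrs) le_rfl)

lemma one_le_moduleDepth_iff [Module.Finite R N] [Nontrivial N] :
    1 ≤ moduleDepth R N ↔ ∃ x ∈ maximalIdeal R, IsSMulRegular N x := by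
  rw [← Nat.cast_one, natCast_le_moduleDepth_iff]
  constructor
  · rintro ⟨rs, hlen, h𝔪, hrs⟩
    obtain ⟨x, rfl⟩ := List.length_eq_one_iff.1 hlen
    exact ⟨x, h𝔪 x (by simp), (isWeaklyRegular_singleton_iff N x).1 hrs⟩
  · rintro ⟨x, hx, hreg⟩
    exact ⟨[x], rfl, by simpa using hx, (isWeaklyRegular_singleton_iff N x).2 hreg⟩

lemma moduleDepth_le_supportDim [IsNoetherianRing R] [Module.Finite R N] [Nontrivial N] :
    (moduleDepth R N : WithBot ℕ∞) ≤ supportDim R N := by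
  obtain ⟨d, hd⟩ := WithBot.ne_bot_iff_exists.1 (supportDim_ne_bot_of_nontrivial R N)
  rw [← hd, WithBot.coe_le_coe]
  refine ENat.forall_natCast_le_iff_le.1 fun n hn ↦ ?_
  obtain ⟨rs, rfl, h𝔪, hrs⟩ := natCast_le_moduleDepth_iff.1 hn
  have hreg := IsRegular.of_isWeaklyRegular_of_mem_maximalIdeal N h𝔪 hrs
  have := hreg.quot_ofList_smul_nontrivial ⊤
  have : Nonempty (support R (N ⧸ Ideal.ofList rs • (⊤ : Submodule R N))) :=
    nonempty_support_of_nontrivial.to_subtype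
  have hquot : 0 ≤ supportDim R (N ⧸ Ideal.ofList rs • (⊤ : Submodule R N)) :=
    Order.krullDim_nonneg
  rw [← WithBot.coe_le_coe, hd, ← supportDim_add_length_eq_supportDim_of_isRegular rs hreg]
  exact le_add_of_nonneg_left hquot

lemma moduleDepth_ne_top [IsNoetherianRing R] [Module.Finite R N] [Nontrivial N] :
    moduleDepth R N ≠ ⊤ := by
  intro htop
  have hle := moduleDepth_le_supportDim (R := R) (N := N)
  rw [htop] at hle
  exact ringKrullDim_lt_top.not_ge (hle.trans (supportDim_le_ringKrullDim R N))

lemma moduleDepth_tensorProduct_of_free {K : Type*} [AddCommGroup K] [Module R K]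
    [Module.Free R K] [Module.Finite R K] [Nontrivial K] [Module.Finite R N] [Nontrivial N] :
    moduleDepth R (K ⊗[R] N) = moduleDepth R N := by
  refine ENat.eq_of_forall_natCast_le_iff fun n ↦ ?_
  simp only [natCast_le_moduleDepth_iff, isWeaklyRegular_tensorProduct_iff_of_faithfullyFlat]

end Depth

/-- The isomorphism `M ⊗ M^{⊗ i} ≃ M^{⊗ (i + 1)}`, splitting off the first tensor factor; inductions
on tensor powers rest on it. -/
noncomputable def tensorPowerSuccEquiv (R M : Type*) [CommRing R] [AddCommGroup M] [Module R M]
    (i : ℕ) : M ⊗[R] (⨂[R]^i M) ≃ₗ[R] ⨂[R]^(i + 1) M :=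
  (PiTensorProduct.subsingletonEquiv (R := R) (s := fun _ ↦ M) (0 : Fin 1)).symm.rTensor _ ≪≫ₗ
    TensorPower.mulEquiv ≪≫ₗ TensorPower.cast R M (add_comm 1 i)

section Nontrivial

variable {R : Type*} [CommRing R] [IsLocalRing R] {M : Type*} [AddCommGroup M] [Module R M]

lemma nontrivial_tensorProduct {N : Type*} [AddCommGroup N] [Module R N]
    [Module.Finite R M] [Nontrivial M] [Module.Finite R N] [Nontrivial N] :
    Nontrivial (M ⊗[R] N) := by
  have hM : Nontrivial (ResidueField R ⊗[R] M) := by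
    rwa [← not_subsingleton_iff_nontrivial, subsingleton_tensorProduct,
      not_subsingleton_iff_nontrivial]
  have hN : Nontrivial (ResidueField R ⊗[R] N) := by
    rwa [← not_subsingleton_iff_nontrivial, subsingleton_tensorProduct,
      not_subsingleton_iff_nontrivial]
  rw [← not_subsingleton_iff_nontrivial, ← subsingleton_tensorProduct (R := R),
    not_subsingleton_iff_nontrivial]
  exact (TensorProduct.AlgebraTensorModule.distribBaseChange R (ResidueField R) M N).nontrivial

lemma nontrivial_tensorPower [Module.Finite R M] [Nontrivial M] (i : ℕ) :
    Nontrivial (⨂[R]^i M) := by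
  induction i with
  | zero => exact (TensorPower.algebraMap₀ : R ≃ₗ[R] ⨂[R]^0 M).symm.nontrivial
  | succ i ih =>
    have := nontrivial_tensorProduct (R := R) (M := M) (N := ⨂[R]^i M)
    exact (tensorPowerSuccEquiv R M i).symm.nontrivial

end Nontrivial

section TensorProduct

variable {R : Type*} [CommRing R] {K : Type*} [AddCommGroup K] [Module R K]
  {F : Type*} [AddCommGroup F] [Module R F] {M : Type*} [AddCommGroup M] [Module R M]
  {N : Type*} [AddCommGroup N] [Module R N] {ι : K →ₗ[R] F} {π : F →ₗ[R] M}

lemma mem_smul_top_of_forall_mem_smul_top [Module.Free R K] [Module.Finite R K] {I : Ideal R}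
    (hι : ∀ k, ι k ∈ I • (⊤ : Submodule R F)) : ι ∈ I • (⊤ : Submodule R (K →ₗ[R] F)) := by
  let b := Free.chooseBasis R K
  have hsum : ι = ∑ i, (b.coord i).smulRight (ι (b i)) := by
    refine b.ext fun j ↦ ?_
    simp [Finsupp.single_apply]
  have hcoord (i) := Submodule.smul_top_le_comap_smul_top I
    (LinearMap.smulRightₗ (b.coord i) : F →ₗ[R] K →ₗ[R] F) (hι (b i))
  rw [hsum]
  exact sum_mem fun i _ ↦ hcoord i

lemma rTensor_mem_smul_top {I : Ideal R} (hι : ι ∈ I • (⊤ : Submodule R (K →ₗ[R] F))) :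
    ι.rTensor N ∈ I • (⊤ : Submodule R (K ⊗[R] N →ₗ[R] F ⊗[R] N)) :=
  Submodule.smul_top_le_comap_smul_top I (LinearMap.rTensorHom N) hι

lemma exists_smul_eq_zero_of_rTensor_eq_zero (hinj : Function.Injective ι)
    (hexact : Function.Exact ι π) (hsurj : Function.Surjective π) (S : Submonoid R)
    [Flat R (LocalizedModule S M)] {w : K ⊗[R] N} (hw : ι.rTensor N w = 0) :
    ∃ s ∈ S, s • w = 0 := by
  let ιS := (LocalizedModule.map S ι).restrictScalars R
  let πS := (LocalizedModule.map S π).restrictScalars R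
  have hιS : Function.Injective (ιS.rTensor N) := by
    rw [← LinearMap.lTensor_inj_iff_rTensor_inj]
    exact LinearMap.lTensor_injective_of_exact_of_flat πS
      (LocalizedModule.map_surjective S π hsurj) ιS (LocalizedModule.map_injective S ι hinj)
      (LocalizedModule.map_exact S ι π hexact) N
  have hcomm : ιS ∘ₗ LocalizedModule.mkLinearMap S K = LocalizedModule.mkLinearMap S F ∘ₗ ι := by
    ext k
    simp [ιS, LocalizedModule.map_mk]
  have hw₀ : (LocalizedModule.mkLinearMap S K).rTensor N w = 0 := by
    refine hιS ?_
    rw [← LinearMap.rTensor_comp_apply, hcomm, LinearMap.rTensor_comp_apply, hw, map_zero,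
      map_zero]
  obtain ⟨s, hs⟩ := (IsLocalizedModule.eq_zero_iff S
    (TensorProduct.AlgebraTensorModule.rTensor R N (LocalizedModule.mkLinearMap S K))).1 hw₀
  exact ⟨s, s.2, hs⟩

end TensorProduct

section Torsion

variable {R : Type*} [CommRing R] {N : Type*} [AddCommGroup N] [Module R N]

lemma exists_isSMulRegular_of_torsionBySet_eq_bot [IsNoetherianRing R] [Module.Finite R N]
    {I : Ideal R}
    (h : Submodule.torsionBySet R N I = ⊥) : ∃ x ∈ I, IsSMulRegular N x := by
  have : Subsingleton ((R ⧸ I) →ₗ[R] N) := by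
    refine subsingleton_of_forall_eq 0 fun f ↦ Submodule.linearMap_qext _ (LinearMap.ext_ring ?_)
    have hf : f (Submodule.Quotient.mk 1) ∈ Submodule.torsionBySet R N I := by
      rw [Submodule.mem_torsionBySet_iff]
      rintro ⟨r, hr⟩
      rw [← map_smul, ← Submodule.Quotient.mk_smul, (Submodule.Quotient.mk_eq_zero I).2, map_zero]
      simpa using hr
    rwa [h, Submodule.mem_bot] at hf
  obtain ⟨x, hx, hreg⟩ := IsSMulRegular.subsingleton_linearMap_iff.1 this
  exact ⟨x, by rwa [Ideal.annihilator_quotient] at hx, hreg⟩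

variable (N) in
lemma exists_torsionBySet_quotient_torsionBySet_pow_eq_bot [IsNoetherian R N] (I : Ideal R) :
    ∃ n, Submodule.torsionBySet R
      (N ⧸ Submodule.torsionBySet R N ((I ^ n : Ideal R) : Set R)) I = ⊥ := by
  obtain ⟨n, hn⟩ := monotone_stabilizes_iff_noetherian.2 ‹IsNoetherian R N›
    ⟨fun n ↦ Submodule.torsionBySet R N ((I ^ n : Ideal R) : Set R),
      fun i j hij ↦ Submodule.torsionBySet_le_torsionBySet_pow i j hij I⟩
  refine ⟨n, (Submodule.eq_bot_iff _).2 fun y hy ↦ ?_⟩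
  obtain ⟨y, rfl⟩ := Submodule.Quotient.mk_surjective _ y
  have hIy {s : R} (hs : s ∈ I) : s • y ∈ Submodule.torsionBySet R N ((I ^ n : Ideal R) : Set R) :=
    (Submodule.Quotient.mk_eq_zero _).1 ((Submodule.mem_torsionBySet_iff _ _).1 hy ⟨s, hs⟩)
  have hle : I ^ (n + 1) ≤ LinearMap.ker (LinearMap.toSpanSingleton R N y) := by
    rw [pow_succ, Ideal.mul_le]
    intro r hr s hs
    rw [LinearMap.mem_ker, LinearMap.toSpanSingleton_apply, mul_smul]
    exact (Submodule.mem_torsionBySet_iff _ _).1 (hIy hs) ⟨r, hr⟩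
  have hmem : y ∈ Submodule.torsionBySet R N ((I ^ (n + 1) : Ideal R) : Set R) :=
    (Submodule.mem_torsionBySet_iff _ _).2 fun r ↦ hle r.2
  exact (Submodule.Quotient.mk_eq_zero _).2 ((hn (n + 1) n.le_succ).ge hmem)

end Torsion

section Regular

variable {R : Type*} [CommRing R] [IsLocalRing R] [IsNoetherianRing R]
  {F : Type*} [AddCommGroup F] [Module R F] {M : Type*} [AddCommGroup M] [Module R M]
  {N : Type*} [AddCommGroup N] [Module R N] {π : F →ₗ[R] M}

lemma rTensor_injective_of_isLocallyFreeOnPuncturedSpectrum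
    [Flat R (LinearMap.ker π)] (hπ : Function.Surjective π)
    (hM : IsLocallyFreeOnPuncturedSpectrum R M) {x : R} (hx : x ∈ maximalIdeal R)
    (hreg : IsSMulRegular N x) : Function.Injective ((LinearMap.ker π).subtype.rTensor N) := by
  let K := LinearMap.ker π
  rw [← LinearMap.ker_eq_bot, ← Submodule.subsingleton_iff_eq_bot]
  by_contra! hker
  obtain ⟨p, hp⟩ := associatedPrimes.nonempty R (LinearMap.ker (K.subtype.rTensor N))
  obtain ⟨hprime, w, hw⟩ := isAssociatedPrime_iff.1 hp
  have hmem (r : R) : r ∈ p ↔ r • w = 0 := by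
    rw [hw, Submodule.mem_colon_singleton, Submodule.mem_bot]
  have hne : p ≠ maximalIdeal R := by
    rintro rfl
    have hw₀ : w = 0 := Subtype.ext <|
      (hreg.lTensor _).right_eq_zero_of_smul (congrArg Subtype.val ((hmem x).1 hx))
    exact hprime.ne_top ((Ideal.eq_top_iff_one _).2 ((hmem 1).2 (by rw [hw₀, smul_zero])))
  have := hM ⟨p, hprime⟩ hne
  have : Flat R (LocalizedModule p.primeCompl M) := .trans R (Localization.AtPrime p) _
  obtain ⟨s, hs, hsw⟩ := exists_smul_eq_zero_of_rTensor_eq_zero K.injective_subtype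
    (LinearMap.exact_subtype_ker_map π) hπ p.primeCompl (LinearMap.mem_ker.1 w.2)
  exact hs ((hmem s).2 (Subtype.ext hsw))

/-- Tensoring with `M` keeps the inclusion into `N` of its `𝔪`-power torsion `Γ` injective, so an
element of `𝔪` that is regular on `M ⊗ N` forces `M ⊗ Γ = 0`, hence `Γ = 0`. -/
lemma exists_isSMulRegular_of_tensorProduct [Flat R F] [Module.Finite R M]
    [Nontrivial M] [Module.Finite R N] (hπ : Function.Surjective π) [Flat R (LinearMap.ker π)]
    (hM : IsLocallyFreeOnPuncturedSpectrum R M) {x : R} (hx : x ∈ maximalIdeal R)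
    (hreg : IsSMulRegular (M ⊗[R] N) x) : ∃ y ∈ maximalIdeal R, IsSMulRegular N y := by
  obtain ⟨n, hn⟩ := exists_torsionBySet_quotient_torsionBySet_pow_eq_bot N (maximalIdeal R)
  obtain ⟨y, hy, hyreg⟩ := exists_isSMulRegular_of_torsionBySet_eq_bot hn
  set Γ := Submodule.torsionBySet R N ((maximalIdeal R ^ n : Ideal R) : Set R)
  have hΓinj : Function.Injective (Γ.subtype.lTensor M) :=
    lTensor_injective_of_exact_of_exact_of_rTensor_injective (LinearMap.exact_subtype_ker_map π) hπ
      (LinearMap.exact_subtype_mkQ Γ) Γ.mkQ_surjective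
      (rTensor_injective_of_isLocallyFreeOnPuncturedSpectrum hπ hM hy hyreg)
      (Flat.lTensor_preserves_injective_linearMap _ Γ.injective_subtype)
  have hxΓ : DistribSMul.toLinearMap R Γ (x ^ n) = 0 := LinearMap.ext fun z ↦
    Submodule.torsionBySet_isTorsionBySet _ (a := ⟨x ^ n, Ideal.pow_mem_pow hx n⟩)
  have hxMΓ (z : M ⊗[R] Γ) : x ^ n • z = 0 := by
    have h := LinearMap.lTensor_smul_action M (N := Γ) (x ^ n)
    rw [hxΓ, LinearMap.lTensor_zero] at h
    exact (LinearMap.congr_fun h z).symm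
  have hMΓ : Subsingleton (M ⊗[R] Γ) := subsingleton_of_forall_eq 0 fun z ↦
    ((hreg.pow n).of_injective _ hΓinj).right_eq_zero_of_smul (hxMΓ z)
  have hΓ : Γ = ⊥ := by
    rw [← Submodule.subsingleton_iff_eq_bot]
    contrapose! hMΓ
    exact nontrivial_tensorProduct
  exact ⟨y, hy, ((Submodule.quotEquivOfEqBot Γ hΓ).isSMulRegular_congr y).1 hyreg⟩

end Regular

section Ext

variable {R : Type u} [CommRing R] [Small.{v} R] {X : ModuleCat.{v} R} {I : Ideal R}

lemma ext_comp_mk₀_eq_zero_of_mem_smul_top {A B : ModuleCat.{v} R} (hI : I ≤ annihilator R X)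
    {f : A →ₗ[R] B} (hf : f ∈ I • (⊤ : Submodule R (A →ₗ[R] B))) {n : ℕ} (e : Ext X A n) :
    e.comp (.mk₀ (ModuleCat.ofHom f)) (add_zero n) = 0 := by
  induction hf using Submodule.smul_induction_on' with
  | smul r hr g _ =>
    have hrX : r • 𝟙 X = 0 := ModuleCat.hom_ext (mem_annihilator_iff_lsmul_eq_zero.1 (hI hr))
    have hre : r • e = 0 := by
      rw [← e.mk₀_id_comp, ← Ext.smul_comp, ← Ext.mk₀_smul, hrX, Ext.mk₀_zero, Ext.zero_comp]
    have hsmul : ModuleCat.ofHom (r • g) = r • ModuleCat.ofHom g := rfl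
    rw [hsmul, Ext.mk₀_smul, Ext.comp_smul, ← Ext.smul_comp, hre, Ext.zero_comp]
  | add f _ g _ hf hg =>
    rw [ModuleCat.ofHom_add, Ext.mk₀_add, Ext.comp_add, hf, hg, add_zero]

/-- A map with coefficients in the annihilator of `X` induces zero on `Ext X`, so the long exact
sequence breaks up into short ones. -/
lemma subsingleton_ext_iff_of_mem_smul_top {S : ShortComplex (ModuleCat.{v} R)}
    (hS : S.ShortExact) (hI : I ≤ annihilator R X)
    (hf : S.f.hom ∈ I • (⊤ : Submodule R (S.X₁ →ₗ[R] S.X₂))) (n : ℕ) :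
    Subsingleton (Ext X S.X₃ n) ↔
      Subsingleton (Ext X S.X₂ n) ∧ Subsingleton (Ext X S.X₁ (n + 1)) := by
  have hf' {m : ℕ} (e : Ext X S.X₁ m) : e.comp (.mk₀ S.f) (add_zero m) = 0 :=
    ext_comp_mk₀_eq_zero_of_mem_smul_top hI hf e
  constructor
  · intro h
    refine ⟨subsingleton_of_forall_eq 0 fun e ↦ ?_, subsingleton_of_forall_eq 0 fun e ↦ ?_⟩
    · obtain ⟨e', rfl⟩ := Ext.covariant_sequence_exact₂ X hS e (Subsingleton.elim _ _)
      exact hf' e'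
    · obtain ⟨e', rfl⟩ := Ext.covariant_sequence_exact₁ X hS e (hf' e) rfl
      rw [Subsingleton.elim e' 0, Ext.zero_comp]
  · rintro ⟨h₂, h₁⟩
    refine subsingleton_of_forall_eq 0 fun e ↦ ?_
    obtain ⟨e', rfl⟩ := Ext.covariant_sequence_exact₃ X hS e rfl (Subsingleton.elim _ _)
    rw [Subsingleton.elim e' 0, Ext.zero_comp]

lemma subsingleton_ext_zero_of_mem_smul_top {S : ShortComplex (ModuleCat.{v} R)}
    (hS : S.ShortExact) (hI : I ≤ annihilator R X)
    (hf : S.f.hom ∈ I • (⊤ : Submodule R (S.X₁ →ₗ[R] S.X₂))) : Subsingleton (Ext X S.X₁ 0) := by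
  have := hS.mono_f
  refine subsingleton_of_forall_eq 0 fun e ↦ Ext.postcomp_mk₀_injective_of_mono X S.f ?_
  rw [map_zero]
  exact ext_comp_mk₀_eq_zero_of_mem_smul_top hI hf e

variable [IsLocalRing R] [IsNoetherianRing R]

lemma natCast_le_moduleDepth_iff_subsingleton_ext {N : ModuleCat.{v} R}
    [Module.Finite R N] [Nontrivial N] {n : ℕ} :
    (n : ℕ∞) ≤ moduleDepth R N ↔
      ∀ i < n, Subsingleton (Ext (ModuleCat.of R (Shrink.{v} (R ⧸ maximalIdeal R))) N i) := by
  have hlt : maximalIdeal R • (⊤ : Submodule R N) < ⊤ :=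
    (Submodule.top_ne_ideal_smul_of_le_jacobson_annihilator
      (maximalIdeal_le_jacobson _)).symm.lt_top
  have hrees := (ModuleCat.exists_isRegular_tfae (maximalIdeal R) n N hlt).out 1 3
  refine natCast_le_moduleDepth_iff.trans (.trans ?_ hrees.symm)
  refine exists_congr fun rs ↦ and_congr_right fun _ ↦ and_congr_right fun h𝔪 ↦ ?_
  exact (isRegular_iff_isWeaklyRegular_of_subset_maximalIdeal h𝔪).symm

lemma natCast_le_moduleDepth_iff_of_mem_smul_top {A B C : Type v}
    [AddCommGroup A] [Module R A] [Module.Finite R A] [Nontrivial A]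
    [AddCommGroup B] [Module R B] [Module.Finite R B] [Nontrivial B]
    [AddCommGroup C] [Module R C] [Module.Finite R C] [Nontrivial C]
    {f : A →ₗ[R] B} {g : B →ₗ[R] C} (hinj : Function.Injective f) (hexact : Function.Exact f g)
    (hsurj : Function.Surjective g) (hf : f ∈ maximalIdeal R • (⊤ : Submodule R (A →ₗ[R] B)))
    {n : ℕ} :
    (n : ℕ∞) ≤ moduleDepth R C ↔
      (n : ℕ∞) ≤ moduleDepth R B ∧ ((n + 1 : ℕ) : ℕ∞) ≤ moduleDepth R A := by
  let k := ModuleCat.of R (Shrink.{v} (R ⧸ maximalIdeal R))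
  have hk : maximalIdeal R ≤ annihilator R k := by
    rw [(Shrink.linearEquiv R (R ⧸ maximalIdeal R)).annihilator_eq, Ideal.annihilator_quotient]
  let S := ShortComplex.moduleCatMk f g hexact.linearMap_comp_eq_zero
  have hS : S.ShortExact :=
    { exact := (ShortComplex.ShortExact.moduleCat_exact_iff_function_exact S).2 hexact
      mono_f := (ModuleCat.mono_iff_injective S.f).2 hinj
      epi_g := (ModuleCat.epi_iff_surjective S.g).2 hsurj }
  have hA := natCast_le_moduleDepth_iff_subsingleton_ext (N := .of R A) (n := n + 1)
  have hB := natCast_le_moduleDepth_iff_subsingleton_ext (N := .of R B) (n := n)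
  have hC := natCast_le_moduleDepth_iff_subsingleton_ext (N := .of R C) (n := n)
  have hA₀ := subsingleton_ext_zero_of_mem_smul_top hS hk hf
  rw [hA, hB, hC, Nat.forall_lt_succ_left]
  exact (forall₂_congr fun i _ ↦ subsingleton_ext_iff_of_mem_smul_top hS hk hf i).trans
    (forall₂_and.trans (and_congr_right' (and_iff_right hA₀).symm))

lemma moduleDepth_eq_min_of_mem_smul_top {A B C : Type v}
    [AddCommGroup A] [Module R A] [Module.Finite R A] [Nontrivial A]
    [AddCommGroup B] [Module R B] [Module.Finite R B] [Nontrivial B]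
    [AddCommGroup C] [Module R C] [Module.Finite R C] [Nontrivial C]
    {f : A →ₗ[R] B} {g : B →ₗ[R] C} (hinj : Function.Injective f) (hexact : Function.Exact f g)
    (hsurj : Function.Surjective g) (hf : f ∈ maximalIdeal R • (⊤ : Submodule R (A →ₗ[R] B))) :
    moduleDepth R C = min (moduleDepth R B) (moduleDepth R A - 1) := by
  have hle {n : ℕ} := natCast_le_moduleDepth_iff_of_mem_smul_top hinj hexact hsurj hf (n := n)
  have hA : 1 ≤ moduleDepth R A := by simpa using hle (n := 0)
  refine ENat.eq_of_forall_natCast_le_iff fun n ↦ ?_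
  rw [hle, le_min_iff, Nat.cast_succ,
    (ENat.addLECancellable_of_ne_top ENat.one_ne_top).le_tsub_iff_right hA]

end Ext

section DepthTensor

variable {R : Type u} [CommRing R] [IsLocalRing R] [IsNoetherianRing R]
  {F M : Type v} [AddCommGroup F] [Module R F] [Module.Free R F] [Module.Finite R F]
  [AddCommGroup M] [Module R M] [Module.Finite R M] [Nontrivial M] {π : F →ₗ[R] M}
  [Module.Free R (LinearMap.ker π)] [Nontrivial (LinearMap.ker π)]

lemma moduleDepth_tensorProduct {N : Type w} [AddCommGroup N] [Module R N] [Module.Finite R N]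
    [Nontrivial N] [Small.{max v w} R] (hπ : Function.Surjective π)
    (hker : LinearMap.ker π ≤ maximalIdeal R • ⊤) (hM : IsLocallyFreeOnPuncturedSpectrum R M) :
    moduleDepth R (M ⊗[R] N) = moduleDepth R N - 1 := by
  have : Nontrivial F := (LinearMap.ker π).injective_subtype.nontrivial
  have : Nontrivial (M ⊗[R] N) := nontrivial_tensorProduct
  by_cases hN : 1 ≤ moduleDepth R N
  · obtain ⟨x, hx, hreg⟩ := one_le_moduleDepth_iff.1 hN
    have hmin : (LinearMap.ker π).subtype ∈ maximalIdeal R • (⊤ : Submodule R _) :=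
      mem_smul_top_of_forall_mem_smul_top fun k ↦ hker k.2
    rw [moduleDepth_eq_min_of_mem_smul_top
      (rTensor_injective_of_isLocallyFreeOnPuncturedSpectrum hπ hM hx hreg)
      (rTensor_exact N (LinearMap.exact_subtype_ker_map π) hπ) (π.rTensor_surjective N hπ)
      (rTensor_mem_smul_top hmin), moduleDepth_tensorProduct_of_free,
      moduleDepth_tensorProduct_of_free, min_eq_right tsub_le_self]
  · have hMN : ¬ 1 ≤ moduleDepth R (M ⊗[R] N) := by
      rw [one_le_moduleDepth_iff] at hN ⊢
      rintro ⟨x, hx, hreg⟩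
      exact hN (exists_isSMulRegular_of_tensorProduct hπ hM hx hreg)
    rw [Order.one_le_iff_ne_zero, not_not] at hN hMN
    rw [hN, hMN, zero_tsub]

lemma moduleDepth_tensorPower (hπ : Function.Surjective π)
    (hker : LinearMap.ker π ≤ maximalIdeal R • ⊤) (hM : IsLocallyFreeOnPuncturedSpectrum R M)
    (i : ℕ) : moduleDepth R (⨂[R]^i M) = moduleDepth R R - i := by
  induction i with
  | zero =>
    rw [← moduleDepth_congr (TensorPower.algebraMap₀ : R ≃ₗ[R] ⨂[R]^0 M), Nat.cast_zero, tsub_zero]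
  | succ i ih =>
    have : Small.{max u v} R := small_max.{v} R
    have := nontrivial_tensorPower (R := R) (M := M) i
    rw [← moduleDepth_congr (tensorPowerSuccEquiv R M i), moduleDepth_tensorProduct hπ hker hM,
      ih, tsub_tsub, Nat.cast_succ]

end DepthTensor

section ProjectiveDimension

variable {R : Type u} [CommRing R] [Small.{v} R] {M : Type v} [AddCommGroup M] [Module R M]

lemma projectiveDimension_lt_one_iff_projective :
    projectiveDimension (ModuleCat.of R M) < 1 ↔ Module.Projective R M := by
  rw [IsProjective.iff_projective, projective_iff_hasProjectiveDimensionLT_one]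
  exact projectiveDimension_lt_iff (n := 1)

lemma projective_ker_of_projectiveDimension_le_one {F : Type v} [AddCommGroup F] [Module R F]
    [Module.Projective R F] {π : F →ₗ[R] M} (hπ : Function.Surjective π)
    (hM : projectiveDimension (ModuleCat.of R M) ≤ 1) : Module.Projective R (LinearMap.ker π) := by
  have hM' : HasProjectiveDimensionLT (ModuleCat.of R M) 2 :=
    (projectiveDimension_le_iff _ 1).1 hM
  have hker := ((LinearMap.shortExact_shortComplexKer hπ).hasProjectiveDimensionLT_X₃_iff 0
    ((IsProjective.iff_projective F).1 ‹_›)).1 hM'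
  exact (IsProjective.iff_projective _).2 (projective_iff_hasProjectiveDimensionLT_one.2 hker)

variable (R M) in
lemma exists_surjective_ker_le_smul_top [IsLocalRing R] [Module.Finite R M] :
    ∃ (n : ℕ) (π : (Fin n → Shrink.{v} R) →ₗ[R] M),
      Function.Surjective π ∧ LinearMap.ker π ≤ maximalIdeal R • ⊤ := by
  let n := finrank (ResidueField R) (ResidueField R ⊗[R] M)
  let b := finBasis (ResidueField R) (ResidueField R ⊗[R] M)
  have hmk := TensorProduct.mk_surjective R M (ResidueField R) Ideal.Quotient.mk_surjective
  choose v hv using fun i ↦ hmk (b i)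
  let c : Basis (Fin n) R (Fin n → Shrink.{v} R) :=
    .ofEquivFun (LinearEquiv.piCongrRight fun _ ↦ Shrink.linearEquiv R R)
  refine ⟨n, c.constr R v, ?_, fun f hf ↦ ?_⟩
  · rw [← LinearMap.range_eq_top, c.constr_range]
    exact span_eq_top_of_tmul_eq_basis v b hv
  · have hsum : ∑ i, residue R (c.repr f i) • b i = 0 := by
      rw [← map_zero (TensorProduct.mk R (ResidueField R) M 1), ← LinearMap.mem_ker.1 hf,
        c.constr_apply_fintype R, map_sum]
      refine Finset.sum_congr rfl fun i _ ↦ ?_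
      rw [map_smul, hv]
      exact algebraMap_smul (ResidueField R) (c.repr f i) (b i)
    have hcoord := Fintype.linearIndependent_iff.1 b.linearIndependent _ hsum
    rw [← c.sum_repr f]
    exact sum_mem fun i _ ↦
      Submodule.smul_mem_smul ((residue_eq_zero_iff _).1 (hcoord i)) trivial

end ProjectiveDimension

theorem mainTheorem2 (R : Type u) [CommRing R] [IsLocalRing R] [IsNoetherianRing R]
    [Small.{v} R] (M : Type v) [AddCommGroup M] [Module R M] [Module.Finite R M]
    (hfree : IsLocallyFreeOnPuncturedSpectrum R M)
    (hpd : CategoryTheory.projectiveDimension (ModuleCat.of R M) = 1) :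
    moduleDepth R R ≠ ⊤ ∧
    (∀ i : ℕ, 0 < i → (i : ℕ∞) ≤ moduleDepth R R →
      moduleDepth R (⨂[R]^i M) = moduleDepth R R - (i : ℕ∞)) ∧
    (∀ i : ℕ, moduleDepth R R ≤ (i : ℕ∞) → moduleDepth R (⨂[R]^i M) = 0) ∧
    (∀ i : ℕ, moduleDepth R (⨂[R]^i M) = max 0 (moduleDepth R R - (i : ℕ∞))) := by
  have hproj : ¬ Module.Projective R M := by
    rw [← projectiveDimension_lt_one_iff_projective, hpd]
    exact lt_irrefl 1
  have : Nontrivial M := by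
    contrapose! hproj
    infer_instance
  obtain ⟨n, π, hπ, hker⟩ := exists_surjective_ker_le_smul_top R M
  have : Module.Free R (Fin n → Shrink.{v} R) := .of_equiv
    (LinearEquiv.piCongrRight fun _ ↦ (Shrink.linearEquiv R R).symm)
  have : Module.Projective R (LinearMap.ker π) :=
    projective_ker_of_projectiveDimension_le_one hπ hpd.le
  have : Module.Free R (LinearMap.ker π) := free_of_flat_of_isLocalRing
  have : Nontrivial (LinearMap.ker π) := by
    contrapose! hproj
    rw [Submodule.subsingleton_iff_eq_bot, LinearMap.ker_eq_bot] at hproj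
    exact .of_equiv (.ofBijective π ⟨hproj, hπ⟩)
  have hdepth (i : ℕ) := moduleDepth_tensorPower hπ hker hfree i
  exact ⟨moduleDepth_ne_top, fun i _ _ ↦ hdepth i,
    fun i hi ↦ by rw [hdepth, tsub_eq_zero_of_le hi], fun i ↦ by rw [hdepth, max_eq_right zero_le]⟩
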